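/- Setting. Let $\{f(\cdot;\theta)\}_{\theta\in\Theta}$ be a known family of probability densities on $\mathbb R$ (with respect to a fixed $\sigma$-finite measure) with finite means $\mu(\theta)$, and let $I(\theta\|\lambda)$ be the Kullback–Leibler divergence of $f(\cdot;\theta)$ from $f(\cdot;\lambda)$. Assume: (A1) $0<I(\theta\|\lambda)<\infty$ whenever $\mu(\lambda)>\mu(\theta)$; (A2) for every $e>0$ and all $\theta,\lambda\in\Theta$ with $\mu(\lambda)>\mu(\theta)$ there is $\eta>0$ such that $|I(\theta\|\lambda)-I(\theta\|\rho)|<e$ whenever $\rho\in\Theta$ and $\mu(\lambda)<\mu(\rho)<\mu(\lambda)+\eta$; (A3) every real number is $\mu(\theta)$ for some $\theta\in\Theta$. There are $K$ arms; arm $i$ yields i.i.d. rewards with density $f(\cdot;\theta_i)$ and mean $\mu_i=\mu(\theta_i)$. For $\epsilon>0$ let $\mathcal G$ be the unit interval graph on the arms in which $i\ne j$ are adjacent iff $|\mu_i-\mu_j|<\epsilon$. It is revealed to the player, and it is assumed to be connected and not complete. Let $\mathcal N[i]$ be the closed neighborhood of $i$, let $i_{\max}$ and $i_{\min}$ be arms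 with the largest and the smallest mean, let $\mathcal B^*_{i}=\{j:\mathcal N[j]=\mathcal N[i]\}$, let $\mathcal A$ be the set of all arms with the largest mean, and let $\Delta_i=\mu_{i_{\max}}-\mu_i$. The regret $R(T)$ of a (possibly randomized) policy, which chooses the next arm on the basis of the graph and of the past observations, is the expectation of $\sum_{t=1}^T\mu_{i_{\max}}-\sum_{t=1}^T X_{\pi_t}(t)$, where $\pi_t$ is the arm played at time $t$ and $X_{\pi_t}(t)$ the reward obtained. The policy is uniformly good if, for all arm parameters that give rise to the graph $\mathcal G$, $R(T)=o(T^\alpha)$ for every $\alpha>0$. Let $\theta'_j\in\Theta$ be parameters with $\mu(\theta'_j)=\mu_j$ for $j\in\mathcal B^*_{i_{\max}}$, with $\mu(\theta'_j)=\mu_{i_{\max}}+\min_{k\in\mathcal B^*_{i_{\max}}}\mu_k-\mu_{i_{\min}}$ for $j\in\mathcal B^*_{i_{\min}}$, and with $\mu(\theta'_j)=\mu_{i_{\max}}+\min_{k\in\mathcal B^*_{i_{\max}}}\mu_k-\mu_j$ for all other $j$. Let $C_1$ be the optimal value of the linear program $$\mathcal P_1:\quad \min_{\tau\in\mathbb R^K}\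 \sum_{i}\Delta_i\tau_i\quad\text{s.t.}\quad \sum_{j\notin\mathcal B^*_{i_{\max}}}\tau_j I(\theta_j\|\theta'_j)\ge 1,\quad \tau_i\ge\frac1{I(\theta_i\|\theta_{i_{\max}})}\ \ \forall i\in\mathcal B^*_{i_{\max}}\setminus\mathcal A,\quad \tau_i\ge 0\ \ \forall i .$$ Theorem. The minimum $C_1$ is attained, and every uniformly good policy satisfies $$\liminf_{T\to\infty}\frac{R(T)}{\log T}\ \ge\ C_1 .$$ Moreover, the regret of every uniformly good policy is $\Omega\big((1+|\mathcal B^*_{i_{\max}}\setminus\mathcal A|)\log T\big)$ for fixed $\Delta_i$, $I(\theta_i\|\theta'_i)$ and $I(\theta_i\|\theta_{i_{\max}})$, in the following sense: for all $\delta,D>0$ there is $c>0$, depending only on $\delta$ and $D$, such that in every setting as above (with any number of arms and any family of densities) in which $\Delta_i\ge\delta$ for all $i\notin\mathcal A$, $I(\theta_j\|\theta'_j)\le D$ for all $j\notin\mathcal B^*_{i_{\max}}$, and $I(\theta_i\|\theta_{i_{\max}})\le D$ for all $i\in\mathcal B^*_{i_{\max}}\setminus\mathcal A$, every uniformly good policy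 satisfies $$R(T)\ \ge\ c\,\big(1+|\mathcal B^*_{i_{\max}}\setminus\mathcal A|\big)\log T\qquad\text{for all sufficiently large }T .$$ -/

import Mathlib

open MeasureTheory ProbabilityTheory InformationTheory Filter Topology Asymptotics
open scoped ENNReal

namespace UIGBandit

noncomputable section

/-- A known parametric family of reward distributions: probability densities `f(·; θ)` on the
real line, with respect to one reference measure, all having a finite mean. -/
structure ParametricFamily (Θ : Type*) where
  /-- the reference measure -/
  base : Measure ℝ
  sigmaFinite_base : SigmaFinite base
  /-- the density `f(·; θ)` -/
  density : Θ → ℝ → ℝ≥0∞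
  measurable_density : ∀ θ, Measurable (density θ)
  lintegral_density : ∀ θ, ∫⁻ x, density θ x ∂base = 1
  integrable_id : ∀ θ, Integrable (fun x : ℝ => x) (base.withDensity (density θ))

variable {Θ : Type*} {K : ℕ}

namespace ParametricFamily

/-- The distribution with density `f(·; θ)`. -/
def law (F : ParametricFamily Θ) (θ : Θ) : Measure ℝ := F.base.withDensity (F.density θ)

instance (F : ParametricFamily Θ) (θ : Θ) : IsProbabilityMeasure (F.law θ) :=
  ⟨by rw [law, withDensity_apply _ MeasurableSet.univ, Measure.restrict_univ,
    F.lintegral_density θ]⟩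

/-- The mean `μ(θ)`. -/
def mean (F : ParametricFamily Θ) (θ : Θ) : ℝ := ∫ x, x ∂(F.law θ)

/-- The Kullback-Leibler divergence `I(θ ‖ ρ)`, possibly infinite. -/
def kl (F : ParametricFamily Θ) (θ ρ : Θ) : ℝ≥0∞ := klDiv (F.law θ) (F.law ρ)

/-- First regularity assumption: `0 < I(θ ‖ ρ) < ∞` whenever `μ(ρ) > μ(θ)`. -/
def KLFinitePos (F : ParametricFamily Θ) : Prop :=
  ∀ θ ρ : Θ, F.mean θ < F.mean ρ → 0 < F.kl θ ρ ∧ F.kl θ ρ < ∞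

/-- Second regularity assumption: right continuity of `I(θ ‖ ·)` in the mean. -/
def KLRightCont (F : ParametricFamily Θ) : Prop :=
  ∀ e : ℝ, 0 < e → ∀ θ l : Θ, F.mean θ < F.mean l →
    ∃ η : ℝ, 0 < η ∧ ∀ ρ : Θ, F.mean l < F.mean ρ → F.mean ρ < F.mean l + η →
      |(F.kl θ l).toReal - (F.kl θ ρ).toReal| < e

/-- The mean can be any real number. -/
def UnboundedMeans (F : ParametricFamily Θ) : Prop := Function.Surjective F.mean

end ParametricFamily

/-! ### The bandit process -/

/-- What has been observed in the first `n` rounds: the arm played and the reward obtained. -/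
abbrev History (K n : ℕ) : Type := Fin n → Fin K × ℝ

/-- A (possibly randomized) policy: in the round after the first `n` ones, it draws an arm from
a distribution that depends on the past observations. -/
structure Policy (K : ℕ) where
  /-- the distribution of the next arm -/
  select : (n : ℕ) → Kernel (History K n) (Fin K)
  isMarkov_select : ∀ n, IsMarkovKernel (select n)

/-- The reward distribution of each arm, for the arm parameters `θ`. -/
def rewardKernel (F : ParametricFamily Θ) (θ : Fin K → Θ) : Kernel (Fin K) ℝ where
  toFun i := F.law (θ i)
  measurable' := measurable_from_top

/-- The conditional law of the next arm and the next reward, given the past. -/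
def stepKernel (F : ParametricFamily Θ) (θ : Fin K → Θ) (π : Policy K) (n : ℕ) :
    Kernel (History K n) (Fin K × ℝ) :=
  (π.select n) ⊗ₖ (Kernel.prodMkLeft (History K n) (rewardKernel F θ))

/-- The law of the first `n` rounds under the policy `π` and the arm parameters `θ`. -/
def historyLaw (F : ParametricFamily Θ) (θ : Fin K → Θ) (π : Policy K) :
    (n : ℕ) → Measure (History K n)
  | 0 => Measure.dirac Fin.elim0
  | n + 1 => ((historyLaw F θ π n) ⊗ₘ (stepKernel F θ π n)).map
      (fun p => (Fin.snoc (α := fun _ => Fin K × ℝ) p.1 p.2 : History K (n + 1)))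

/-- The largest mean reward. -/
def maxMean (F : ParametricFamily Θ) (θ : Fin K → Θ) : ℝ := ⨆ i, F.mean (θ i)

/-- The suboptimality gap `Δ_i`. -/
def gap (F : ParametricFamily Θ) (θ : Fin K → Θ) (i : Fin K) : ℝ :=
  maxMean F θ - F.mean (θ i)

/-- The regret `R(T)`: the expected reward loss in `T` rounds against always playing an arm with
the largest mean. -/
def regret (F : ParametricFamily Θ) (θ : Fin K → Θ) (π : Policy K) (T : ℕ) : ℝ :=
  ∫ h, (∑ _t : Fin T, maxMean F θ - ∑ t : Fin T, (h t).2) ∂(historyLaw F θ π T)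

/-! ### The similarity graph -/

/-- The unit interval graph of the arms: two arms are adjacent when their means differ by less
than `ε`, that is, when the intervals `(μ_i, μ_i + ε)` and `(μ_j, μ_j + ε)` meet. -/
def simGraph (F : ParametricFamily Θ) (ε : ℝ) (θ : Fin K → Θ) : SimpleGraph (Fin K) where
  Adj i j := i ≠ j ∧ |F.mean (θ i) - F.mean (θ j)| < ε
  symm := ⟨fun i j h => ⟨h.1.symm, by rw [abs_sub_comm]; exact h.2⟩⟩
  loopless := ⟨fun _ h => h.1 rfl⟩

/-- The closed neighborhood `N[i]`. -/
def closedNbhd (G : SimpleGraph (Fin K)) (i : Fin K) : Set (Fin K) := insert i (G.neighborSet i)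

/-- The neighborhood equivalence class of the arm `i`: the arms `j` with `N[j] = N[i]`. -/
def nbhdClass (G : SimpleGraph (Fin K)) (i : Fin K) : Set (Fin K) :=
  {j | closedNbhd G j = closedNbhd G i}

/-- A policy that is given the graph `G` as side information is uniformly good when its regret is
`o(T^α)` for every `α > 0`, whatever the arm parameters conforming to `G` are. -/
def UniformlyGood (F : ParametricFamily Θ) (ε : ℝ) (G : SimpleGraph (Fin K)) (π : Policy K) :
    Prop :=
  ∀ θ : Fin K → Θ, simGraph F ε θ = G → ∀ α : ℝ, 0 < α →
    (fun T : ℕ => regret F θ π T) =o[atTop] (fun T : ℕ => (T : ℝ) ^ α)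

/-! ### The linear program -/

/-- The set `A` of the arms with the largest mean. -/
def optimalArms (F : ParametricFamily Θ) (θ : Fin K → Θ) : Set (Fin K) :=
  {i | ∀ j, F.mean (θ j) ≤ F.mean (θ i)}

/-- The set of the arms with the smallest mean. -/
def worstArms (F : ParametricFamily Θ) (θ : Fin K → Θ) : Set (Fin K) :=
  {i | ∀ j, F.mean (θ i) ≤ F.mean (θ j)}

open Classical in
/-- The alternative means `μ(θ'_j)`: the arms in the class of `imax` keep their mean, those in the
class of `imin` are moved to the mirror image of the smallest mean, and all others (which are the
arms outside the candidate set) are mirrored. -/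
def altMean (F : ParametricFamily Θ) (ε : ℝ) (θ : Fin K → Θ) (imax imin j : Fin K) : ℝ :=
  let B := nbhdClass (simGraph F ε θ) imax
  let c := F.mean (θ imax) + sInf ((fun k => F.mean (θ k)) '' B)
  if j ∈ B then F.mean (θ j)
  else if j ∈ nbhdClass (simGraph F ε θ) imin then c - F.mean (θ imin)
  else c - F.mean (θ j)

open Classical in
/-- The feasible set of the linear program `P₁`. -/
def lpFeasible (F : ParametricFamily Θ) (ε : ℝ) (θ θ' : Fin K → Θ) (imax : Fin K) :
    Set (Fin K → ℝ) :=
  {τ | 1 ≤ ∑ j ∈ Finset.univ.filter (fun j => j ∉ nbhdClass (simGraph F ε θ) imax),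
          τ j * (F.kl (θ j) (θ' j)).toReal ∧
    (∀ i ∈ nbhdClass (simGraph F ε θ) imax \ optimalArms F θ,
      1 / (F.kl (θ i) (θ imax)).toReal ≤ τ i) ∧
    ∀ i, 0 ≤ τ i}

/-- The values `∑ Δ_i τ_i` of the objective of `P₁` at its feasible points. -/
def lpValues (F : ParametricFamily Θ) (ε : ℝ) (θ θ' : Fin K → Θ) (imax : Fin K) : Set ℝ :=
  (fun τ : Fin K → ℝ => ∑ i, gap F θ i * τ i) '' lpFeasible F ε θ θ' imax

end

end UIGBandit

/-!
A policy that is uniformly good for the graph has to rule out every set of arm parameters that gives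
rise to the same graph but has other optimal arms. If the optimal arms of `θ''` are suboptimal for
`θ`, then the event that they are played in fewer than half of the rounds has a probability tending
to one under `θ` and of order `T^(α-1)` under `θ''`, for every `α > 0`. Since the divergence of the
two history laws dominates the log-likelihood ratio of this event, and is at most
`∑ i, E[N_i(T)] * I(θ_i ‖ θ''_i)` by the chain rule, this sum is asymptotically at least `log T`
(`klDiv_historyLaw_le`, `eventually_log_le_sum_kl`).

Two kinds of alternatives are used. The closed neighborhood of an arm in the class of `imax` is that
of `imax`, so raising its mean slightly above the maximum keeps the graph (`simGraph_update_eq`);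
with the right continuity of the divergence this bounds the number of plays of each such suboptimal
arm. Mirroring the means of all arms outside the class of `imax` also keeps the graph
(`simGraph_eq_of_altMean`) and makes the class of `imin` optimal; this gives the remaining constraint
of the linear program. The expected numbers of plays divided by `(1 - e) * log T` are therefore
eventually feasible (`eventually_mul_log_le_regret`), and their objective is the normalized regret
(`regret_eq_sum`). The program splits into one-dimensional bounds and a single fractional constraint,
so that its minimum is explicit (`exists_isLeast_lpValues`) and easily bounded below
(`mul_le_of_mem_lpValues`).
-/

/-! ### Divergence of composition-products and of events -/

namespace MeasureTheory

/-- Restricting both measures to an event does not increase the divergence. -/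
lemma klDiv_restrict_le {α : Type*} {mα : MeasurableSpace α} (μ ν : Measure α)
    [IsFiniteMeasure μ] [IsFiniteMeasure ν] {s : Set α} (hs : MeasurableSet s) :
    klDiv (μ.restrict s) (ν.restrict s) ≤ klDiv μ ν := by
  by_cases hac : μ ≪ ν
  swap; · simp [hac]
  rw [klDiv_eq_lintegral_klFun_of_ac hac, klDiv_eq_lintegral_klFun_of_ac (hac.restrict s)]
  have hrn : (μ.restrict s).rnDeriv (ν.restrict s) =ᵐ[ν.restrict s] μ.rnDeriv ν := by
    have h1 : μ.restrict s = (ν.restrict s).withDensity (μ.rnDeriv ν) := by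
      rw [← restrict_withDensity hs, Measure.withDensity_rnDeriv_eq _ _ hac]
    conv_lhs => rw [h1]
    exact Measure.rnDeriv_withDensity _ (Measure.measurable_rnDeriv _ _)
  calc ∫⁻ x, ENNReal.ofReal (klFun ((μ.restrict s).rnDeriv (ν.restrict s) x).toReal) ∂ν.restrict s
      = ∫⁻ x, ENNReal.ofReal (klFun (μ.rnDeriv ν x).toReal) ∂ν.restrict s := by
        refine lintegral_congr_ae ?_
        filter_upwards [hrn] with x hx
        rw [hx]
    _ ≤ _ := setLIntegral_le_lintegral _ _

/-- The divergence bounds the log-likelihood ratio of a single event. -/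
lemma measureReal_mul_log_le_toReal_klDiv {α : Type*} {mα : MeasurableSpace α} (μ ν : Measure α)
    [IsFiniteMeasure μ] [IsFiniteMeasure ν] {s : Set α} (hs : MeasurableSet s)
    (hfin : klDiv μ ν ≠ ∞) :
    μ.real s * Real.log (μ.real s / ν.real s) + ν.real s - μ.real s ≤ (klDiv μ ν).toReal := by
  have h := (mul_log_le_klDiv (μ.restrict s) (ν.restrict s)).trans (klDiv_restrict_le μ ν hs)
  simpa using (ENNReal.ofReal_le_iff_le_toReal hfin).1 h

/-- The conditional divergence of two kernels on a finite type that are composed with a law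
whose second coordinate is the index. -/
lemma klDiv_compProd_prodMkLeft {α ι β : Type*} [MeasurableSpace α] [MeasurableSpace β]
    [Fintype ι] [MeasurableSpace ι] [DiscreteMeasurableSpace ι] (ρ : Measure (α × ι))
    [IsFiniteMeasure ρ] (κ η : Kernel ι β) [IsMarkovKernel κ] [IsMarkovKernel η]
    (hac : ∀ i, κ i ≪ η i) :
    klDiv (ρ ⊗ₘ Kernel.prodMkLeft α κ) (ρ ⊗ₘ Kernel.prodMkLeft α η)
      = ∑ i, ρ (Prod.snd ⁻¹' {i}) * klDiv (κ i) (η i) := by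
  set f : α × ι → β → ℝ≥0∞ := fun p => (κ p.2).rnDeriv (η p.2) with hf
  have hfm : Measurable (Function.uncurry f) := by
    have h0 : Measurable (fun q : β × ι => (κ q.2).rnDeriv (η q.2) q.1) :=
      measurable_from_prod_countable_left
        (fun i => Measure.measurable_rnDeriv (κ i) (η i))
    exact h0.comp (f := fun q : (α × ι) × β => (q.2, q.1.2)) (by fun_prop)
  have hκ : Kernel.prodMkLeft α κ = (Kernel.prodMkLeft α η).withDensity f := by
    ext1 p
    rw [Kernel.withDensity_apply _ hfm, Kernel.prodMkLeft_apply, Kernel.prodMkLeft_apply]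
    exact (Measure.withDensity_rnDeriv_eq _ _ (hac p.2)).symm
  have : IsSFiniteKernel ((Kernel.prodMkLeft α η).withDensity f) := hκ ▸ inferInstance
  have hμ : ρ ⊗ₘ Kernel.prodMkLeft α κ
      = (ρ ⊗ₘ Kernel.prodMkLeft α η).withDensity (fun q => f q.1 q.2) := by
    rw [hκ, Measure.compProd_withDensity hfm]
  have hac' : ρ ⊗ₘ Kernel.prodMkLeft α κ ≪ ρ ⊗ₘ Kernel.prodMkLeft α η := by
    rw [hμ]; exact withDensity_absolutelyContinuous _ _
  have hrn : (ρ ⊗ₘ Kernel.prodMkLeft α κ).rnDeriv (ρ ⊗ₘ Kernel.prodMkLeft α η)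
      =ᵐ[ρ ⊗ₘ Kernel.prodMkLeft α η] fun q => f q.1 q.2 := by
    conv_lhs => rw [hμ]
    exact Measure.rnDeriv_withDensity _ hfm
  have hfm' : Measurable fun q : (α × ι) × β => f q.1 q.2 := hfm
  rw [klDiv_eq_lintegral_klFun_of_ac hac']
  calc _ = ∫⁻ q, ENNReal.ofReal (klFun (f q.1 q.2).toReal) ∂(ρ ⊗ₘ Kernel.prodMkLeft α η) := by
        refine lintegral_congr_ae ?_
        filter_upwards [hrn] with q hq
        rw [hq]
    _ = ∫⁻ p, klDiv (κ p.2) (η p.2) ∂ρ := by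
        rw [Measure.lintegral_compProd (by fun_prop)]
        refine lintegral_congr fun p => ?_
        rw [klDiv_eq_lintegral_klFun_of_ac (hac p.2), Kernel.prodMkLeft_apply]
    _ = ∫⁻ i, klDiv (κ i) (η i) ∂(ρ.map Prod.snd) :=
        (lintegral_map (f := fun i => klDiv (κ i) (η i)) Measurable.of_discrete
          measurable_snd).symm
    _ = _ := by
        rw [lintegral_fintype]
        refine Finset.sum_congr rfl fun i _ => ?_
        rw [Measure.map_apply measurable_snd (MeasurableSet.singleton i), mul_comm]

end MeasureTheory

namespace UIGBandit

noncomputable section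

variable {Θ : Type*} {K : ℕ}

/-! ### The history process -/

instance (π : Policy K) (n : ℕ) : IsMarkovKernel (π.select n) := π.isMarkov_select n

instance (F : ParametricFamily Θ) (θ : Fin K → Θ) : IsMarkovKernel (rewardKernel F θ) :=
  ⟨fun i => inferInstanceAs (IsProbabilityMeasure (F.law (θ i)))⟩

/-- A history extended by one round, as a function of the history, the arm and the reward. -/
def extendHistory (n : ℕ) (q : (History K n × Fin K) × ℝ) : History K (n + 1) :=
  Fin.snoc (α := fun _ => Fin K × ℝ) q.1.1 (q.1.2, q.2)

lemma measurable_snoc_history (n : ℕ) :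
    Measurable (fun p : History K n × (Fin K × ℝ) =>
      (Fin.snoc (α := fun _ => Fin K × ℝ) p.1 p.2 : History K (n + 1))) := by
  refine measurable_pi_lambda _ fun t => ?_
  refine Fin.lastCases ?_ (fun t => ?_) t
  · simpa using measurable_snd
  · simp only [Fin.snoc_castSucc]
    exact (measurable_pi_apply t).comp measurable_fst

lemma measurable_extendHistory (n : ℕ) : Measurable (extendHistory (K := K) n) :=
  (measurable_snoc_history n).comp (f := fun q : (History K n × Fin K) × ℝ => (q.1.1, q.1.2, q.2))
    (by fun_prop)

instance isProbabilityMeasure_historyLaw (F : ParametricFamily Θ) (θ : Fin K → Θ) (π : Policy K)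
    (n : ℕ) : IsProbabilityMeasure (historyLaw F θ π n) := by
  induction n with
  | zero => exact inferInstanceAs (IsProbabilityMeasure (Measure.dirac _))
  | succ n ih =>
    have : IsMarkovKernel (stepKernel F θ π n) := by unfold stepKernel; infer_instance
    exact Measure.isProbabilityMeasure_map (measurable_snoc_history n).aemeasurable

/-- The joint law of the first `n` rounds and the arm that is played next. -/
def playLaw (F : ParametricFamily Θ) (θ : Fin K → Θ) (π : Policy K) (n : ℕ) :
    Measure (History K n × Fin K) :=
  historyLaw F θ π n ⊗ₘ π.select n

instance (F : ParametricFamily Θ) (θ : Fin K → Θ) (π : Policy K) (n : ℕ) :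
    IsProbabilityMeasure (playLaw F θ π n) := by unfold playLaw; infer_instance

lemma historyLaw_succ (F : ParametricFamily Θ) (θ : Fin K → Θ) (π : Policy K) (n : ℕ) :
    historyLaw F θ π (n + 1)
      = (playLaw F θ π n ⊗ₘ Kernel.prodMkLeft (History K n) (rewardKernel F θ)).map
        (extendHistory n) := by
  rw [historyLaw, stepKernel, ← Measure.compProd_assoc', Measure.map_map
    (measurable_snoc_history n) (by fun_prop)]
  rfl

/-! ### Pull counts and the regret -/

/-- The number of rounds of a history in which the arm `i` was played. -/
def pullCount {n : ℕ} (i : Fin K) (h : History K n) : ℝ :=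
  ∑ t, if (h t).1 = i then 1 else 0

/-- The expected number of plays of the arm `i` in the first `T` rounds. -/
def expectedPulls (F : ParametricFamily Θ) (θ : Fin K → Θ) (π : Policy K) (T : ℕ) (i : Fin K) :
    ℝ :=
  ∫ h, pullCount i h ∂(historyLaw F θ π T)

lemma measurable_pullCount {n : ℕ} (i : Fin K) : Measurable (pullCount (n := n) i) := by
  unfold pullCount
  refine Finset.measurable_sum _ fun t _ => ?_
  refine Measurable.ite ?_ measurable_const measurable_const
  exact (measurable_fst.comp (measurable_pi_apply t)) (MeasurableSet.singleton i)

lemma pullCount_nonneg {n : ℕ} (i : Fin K) (h : History K n) : 0 ≤ pullCount i h :=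
  Finset.sum_nonneg fun t _ => by split_ifs <;> norm_num

lemma pullCount_le {n : ℕ} (i : Fin K) (h : History K n) : pullCount i h ≤ n := by
  calc pullCount i h ≤ ∑ _t : Fin n, (1 : ℝ) :=
        Finset.sum_le_sum fun t _ => by split_ifs <;> norm_num
    _ = n := by simp

lemma sum_pullCount {n : ℕ} (h : History K n) : ∑ i, pullCount i h = n := by
  unfold pullCount
  rw [Finset.sum_comm]
  simp

lemma integrable_pullCount (F : ParametricFamily Θ) (θ : Fin K → Θ) (π : Policy K) (n : ℕ)
    (i : Fin K) : Integrable (pullCount i) (historyLaw F θ π n) := by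
  refine Integrable.of_bound (measurable_pullCount i).aestronglyMeasurable (n : ℝ) ?_
  refine ae_of_all _ fun h => ?_
  rw [Real.norm_of_nonneg (pullCount_nonneg i h)]
  exact pullCount_le i h

lemma expectedPulls_nonneg (F : ParametricFamily Θ) (θ : Fin K → Θ) (π : Policy K) (n : ℕ)
    (i : Fin K) : 0 ≤ expectedPulls F θ π n i :=
  integral_nonneg fun h => pullCount_nonneg i h

lemma pullCount_extendHistory {n : ℕ} (i : Fin K) (q : (History K n × Fin K) × ℝ) :
    pullCount i (extendHistory n q) = pullCount i q.1.1 + if q.1.2 = i then 1 else 0 := by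
  simp [pullCount, extendHistory, Fin.sum_univ_castSucc]

/-- Functions of the past have the same law under the extended process. -/
lemma map_fst_fst_compProd (F : ParametricFamily Θ) (θ : Fin K → Θ) (π : Policy K) (n : ℕ) :
    (playLaw F θ π n ⊗ₘ Kernel.prodMkLeft (History K n) (rewardKernel F θ)).map
      (fun q => q.1.1) = historyLaw F θ π n := by
  have : (fun q : (History K n × Fin K) × ℝ => q.1.1) = Prod.fst ∘ Prod.fst := rfl
  rw [this, ← Measure.map_map measurable_fst measurable_fst]
  change Measure.fst (Measure.fst _) = _
  rw [Measure.fst_compProd, playLaw, Measure.fst_compProd]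

lemma integrable_comp_past (F : ParametricFamily Θ) (θ : Fin K → Θ) (π : Policy K) (n : ℕ)
    {g : History K n → ℝ} (hg : Integrable g (historyLaw F θ π n)) :
    Integrable (fun q : (History K n × Fin K) × ℝ => g q.1.1)
      (playLaw F θ π n ⊗ₘ Kernel.prodMkLeft (History K n) (rewardKernel F θ)) := by
  rw [← map_fst_fst_compProd] at hg
  exact hg.comp_measurable (by fun_prop)

lemma integral_comp_past (F : ParametricFamily Θ) (θ : Fin K → Θ) (π : Policy K) (n : ℕ)
    {g : History K n → ℝ} (hg : Integrable g (historyLaw F θ π n)) :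
    ∫ q, g q.1.1 ∂(playLaw F θ π n ⊗ₘ Kernel.prodMkLeft (History K n) (rewardKernel F θ))
      = ∫ h, g h ∂(historyLaw F θ π n) := by
  conv_rhs => rw [← map_fst_fst_compProd]
  rw [← map_fst_fst_compProd] at hg
  exact (integral_map (by fun_prop) hg.aestronglyMeasurable).symm

lemma integral_comp_arm (F : ParametricFamily Θ) (θ : Fin K → Θ) (π : Policy K) (n : ℕ)
    (g : Fin K → ℝ) :
    ∫ p, g p.2 ∂(playLaw F θ π n)
      = ∑ i, (playLaw F θ π n).real (Prod.snd ⁻¹' {i}) * g i := by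
  have h := integral_map (μ := playLaw F θ π n) (φ := Prod.snd) measurable_snd.aemeasurable
    (f := g) (Measurable.of_discrete.aestronglyMeasurable)
  rw [← h]
  have : IsProbabilityMeasure ((playLaw F θ π n).map Prod.snd) :=
    Measure.isProbabilityMeasure_map measurable_snd.aemeasurable
  rw [integral_fintype Integrable.of_finite]
  refine Finset.sum_congr rfl fun i _ => ?_
  rw [map_measureReal_apply measurable_snd (MeasurableSet.singleton i), smul_eq_mul]

lemma expectedPulls_zero (F : ParametricFamily Θ) (θ : Fin K → Θ) (π : Policy K) (i : Fin K) :
    expectedPulls F θ π 0 i = 0 := by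
  simp [expectedPulls, pullCount]

lemma expectedPulls_succ (F : ParametricFamily Θ) (θ : Fin K → Θ) (π : Policy K) (n : ℕ)
    (i : Fin K) :
    expectedPulls F θ π (n + 1) i
      = expectedPulls F θ π n i + (playLaw F θ π n).real (Prod.snd ⁻¹' {i}) := by
  have hint := integrable_comp_past F θ π n (integrable_pullCount F θ π n i)
  have hm : Measurable (fun q : (History K n × Fin K) × ℝ => if q.1.2 = i then (1 : ℝ) else 0) :=
    (Measurable.of_discrete (f := fun j : Fin K => if j = i then (1 : ℝ) else 0)).comp
      (measurable_snd.comp measurable_fst)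
  have hint2 : Integrable (fun q : (History K n × Fin K) × ℝ => if q.1.2 = i then (1 : ℝ) else 0)
      (playLaw F θ π n ⊗ₘ Kernel.prodMkLeft (History K n) (rewardKernel F θ)) :=
    Integrable.of_bound hm.aestronglyMeasurable 1
      (ae_of_all _ fun q => by split_ifs <;> simp)
  rw [expectedPulls, historyLaw_succ, integral_map (measurable_extendHistory n).aemeasurable
    (measurable_pullCount i).aestronglyMeasurable]
  simp_rw [pullCount_extendHistory]
  rw [integral_add hint hint2, integral_comp_past F θ π n (integrable_pullCount F θ π n i),
    Measure.integral_compProd hint2]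
  have hconst : ∀ p : History K n × Fin K,
      ∫ _x, (if p.2 = i then (1 : ℝ) else 0)
        ∂(Kernel.prodMkLeft (History K n) (rewardKernel F θ) p) = if p.2 = i then 1 else 0 :=
    fun p => by rw [integral_const, probReal_univ, one_smul]
  simp_rw [hconst]
  rw [integral_comp_arm F θ π n (fun j => if j = i then 1 else 0)]
  simp [expectedPulls]

/-- The realized loss of a history against always playing an arm of largest mean. -/
def realizedLoss (F : ParametricFamily Θ) (θ : Fin K → Θ) {n : ℕ} (h : History K n) : ℝ :=
  ∑ t, (maxMean F θ - (h t).2)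

lemma integrable_reward (F : ParametricFamily Θ) (θ : Fin K → Θ) (i : Fin K) :
    Integrable (fun x : ℝ => x) (rewardKernel F θ i) := F.integrable_id (θ i)

lemma integrable_loss_step (F : ParametricFamily Θ) (θ : Fin K → Θ) (π : Policy K) (n : ℕ) :
    Integrable (fun q : (History K n × Fin K) × ℝ => maxMean F θ - q.2)
      (playLaw F θ π n ⊗ₘ Kernel.prodMkLeft (History K n) (rewardKernel F θ)) := by
  rw [Measure.integrable_compProd_iff (by fun_prop)]
  constructor
  · refine ae_of_all _ fun p => ?_
    exact (integrable_const _).sub (integrable_reward F θ p.2)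
  · set g : Fin K → ℝ := fun i => ∫ x, ‖maxMean F θ - x‖ ∂(rewardKernel F θ i)
    have hg : Measurable (fun p : History K n × Fin K => g p.2) :=
      (Measurable.of_discrete (f := g)).comp measurable_snd
    exact Integrable.of_bound hg.aestronglyMeasurable (∑ i, ‖g i‖)
      (ae_of_all _ fun p => Finset.single_le_sum (f := fun i => ‖g i‖)
        (fun i _ => norm_nonneg _) (Finset.mem_univ p.2))

/-- The regret is the sum of the gaps weighted by the expected numbers of plays. -/
lemma regret_eq_sum (F : ParametricFamily Θ) (θ : Fin K → Θ) (π : Policy K) (T : ℕ) :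
    regret F θ π T = ∑ i, gap F θ i * expectedPulls F θ π T i := by
  suffices h : Integrable (realizedLoss F θ) (historyLaw F θ π T) ∧
      ∫ h, realizedLoss F θ h ∂(historyLaw F θ π T)
        = ∑ i, gap F θ i * expectedPulls F θ π T i by
    rw [← h.2, regret]
    simp [realizedLoss, Finset.sum_sub_distrib]
  induction T with
  | zero => simp [realizedLoss, expectedPulls_zero]
  | succ n ih =>
    have hmeas : Measurable (realizedLoss F θ (n := n + 1)) := by
      unfold realizedLoss
      fun_prop
    have hext : ∀ q : (History K n × Fin K) × ℝ,
        realizedLoss F θ (extendHistory n q)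
          = realizedLoss F θ q.1.1 + (maxMean F θ - q.2) := fun q => by
      simp only [realizedLoss, extendHistory, Fin.sum_univ_castSucc, Fin.snoc_castSucc,
        Fin.snoc_last]
    have hint := integrable_comp_past F θ π n ih.1
    have hint2 := integrable_loss_step F θ π n
    rw [historyLaw_succ, integrable_map_measure hmeas.aestronglyMeasurable
      (measurable_extendHistory n).aemeasurable,
      integral_map (measurable_extendHistory n).aemeasurable hmeas.aestronglyMeasurable]
    have hcomp : realizedLoss F θ ∘ extendHistory n
        = fun q : (History K n × Fin K) × ℝ => realizedLoss F θ q.1.1 + (maxMean F θ - q.2) :=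
      funext hext
    refine ⟨by rw [hcomp]; exact hint.add hint2, ?_⟩
    simp_rw [hext]
    rw [integral_add hint hint2, integral_comp_past F θ π n ih.1, ih.2,
      Measure.integral_compProd hint2]
    have hgap : ∀ p : History K n × Fin K,
        ∫ x, (maxMean F θ - x) ∂(Kernel.prodMkLeft (History K n) (rewardKernel F θ) p)
          = gap F θ p.2 := fun p => by
      rw [Kernel.prodMkLeft_apply, integral_sub (integrable_const _) (integrable_reward F θ p.2)]
      simp only [integral_const, probReal_univ, one_smul]
      rfl
    simp_rw [hgap]
    rw [integral_comp_arm, ← Finset.sum_add_distrib]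
    refine Finset.sum_congr rfl fun i _ => ?_
    rw [expectedPulls_succ]
    ring

/-! ### Divergence of the history laws -/

/-- Two bandits played by the same policy diverge by at most the divergences of their arms,
weighted by the expected numbers of plays. -/
lemma klDiv_historyLaw_le (F : ParametricFamily Θ) (θ θ'' : Fin K → Θ) (π : Policy K)
    (hfin : ∀ i, F.kl (θ i) (θ'' i) ≠ ∞) (T : ℕ) :
    klDiv (historyLaw F θ π T) (historyLaw F θ'' π T)
      ≤ ENNReal.ofReal (∑ i, expectedPulls F θ π T i * (F.kl (θ i) (θ'' i)).toReal) := by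
  have hac : ∀ i, rewardKernel F θ i ≪ rewardKernel F θ'' i := fun i =>
    (klDiv_ne_top_iff.1 (hfin i)).1
  induction T with
  | zero =>
    have : klDiv (historyLaw F θ π 0) (historyLaw F θ'' π 0) = 0 := by
      simp [historyLaw]
    rw [this]
    exact zero_le
  | succ n ih =>
    rw [historyLaw_succ, historyLaw_succ]
    refine (klDiv_map_le _ _ (measurable_extendHistory n)).trans ?_
    rw [klDiv_compProd_eq_add, klDiv_compProd_prodMkLeft _ _ _ hac]
    have h1 : klDiv (playLaw F θ π n) (playLaw F θ'' π n)
        = klDiv (historyLaw F θ π n) (historyLaw F θ'' π n) := klDiv_compProd_left _ _ _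
    have h2 : ∑ i, playLaw F θ π n (Prod.snd ⁻¹' {i})
          * klDiv (rewardKernel F θ i) (rewardKernel F θ'' i)
        = ENNReal.ofReal (∑ i, (playLaw F θ π n).real (Prod.snd ⁻¹' {i})
          * (F.kl (θ i) (θ'' i)).toReal) := by
      rw [ENNReal.ofReal_sum_of_nonneg fun i _ => by positivity]
      refine Finset.sum_congr rfl fun i _ => ?_
      rw [ENNReal.ofReal_mul measureReal_nonneg, ofReal_measureReal,
        ENNReal.ofReal_toReal (hfin i)]
      rfl
    rw [h1, h2]
    refine (add_le_add_left ih _).trans ?_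
    rw [← ENNReal.ofReal_add]
    · refine ENNReal.ofReal_le_ofReal (le_of_eq ?_)
      rw [← Finset.sum_add_distrib]
      refine Finset.sum_congr rfl fun i _ => ?_
      rw [expectedPulls_succ]
      ring
    · exact Finset.sum_nonneg fun i _ =>
        mul_nonneg (expectedPulls_nonneg F θ π n i) ENNReal.toReal_nonneg
    · exact Finset.sum_nonneg fun i _ => by positivity

/-! ### Suboptimal arms are rarely played -/

lemma mean_le_maxMean (F : ParametricFamily Θ) (θ : Fin K → Θ) (i : Fin K) :
    F.mean (θ i) ≤ maxMean F θ :=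
  le_ciSup (f := fun i => F.mean (θ i)) (Set.finite_range _).bddAbove i

lemma maxMean_eq_of_mem_optimalArms {F : ParametricFamily Θ} {θ : Fin K → Θ} {i : Fin K}
    (hi : i ∈ optimalArms F θ) : maxMean F θ = F.mean (θ i) :=
  have : Nonempty (Fin K) := ⟨i⟩
  le_antisymm (ciSup_le hi) (mean_le_maxMean F θ i)

lemma gap_nonneg (F : ParametricFamily Θ) (θ : Fin K → Θ) (i : Fin K) : 0 ≤ gap F θ i :=
  sub_nonneg.2 (mean_le_maxMean F θ i)

lemma gap_eq_zero {F : ParametricFamily Θ} {θ : Fin K → Θ} {i : Fin K}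
    (hi : i ∈ optimalArms F θ) : gap F θ i = 0 := by
  rw [gap, maxMean_eq_of_mem_optimalArms hi, sub_self]

lemma gap_pos {F : ParametricFamily Θ} {θ : Fin K → Θ} {i : Fin K}
    (hi : i ∉ optimalArms F θ) : 0 < gap F θ i := by
  simp only [optimalArms, Set.mem_ofPred_eq, not_forall, not_le] at hi
  obtain ⟨j, hj⟩ := hi
  exact sub_pos.2 (hj.trans_le (mean_le_maxMean F θ j))

/-- Under a uniformly good policy, each suboptimal arm is played `o(T^α)` times on average. -/
lemma expectedPulls_isLittleO {F : ParametricFamily Θ} {ε : ℝ} {G : SimpleGraph (Fin K)}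
    {π : Policy K} (hπ : UniformlyGood F ε G π) {θ : Fin K → Θ} (hG : simGraph F ε θ = G)
    {i : Fin K} (hi : i ∉ optimalArms F θ) {α : ℝ} (hα : 0 < α) :
    (fun T : ℕ => expectedPulls F θ π T i) =o[atTop] (fun T : ℕ => (T : ℝ) ^ α) := by
  refine IsBigO.trans_isLittleO ?_ (hπ θ hG α hα)
  refine IsBigO.of_bound (gap F θ i)⁻¹ (Eventually.of_forall fun T => ?_)
  have h1 : gap F θ i * expectedPulls F θ π T i ≤ regret F θ π T := by
    rw [regret_eq_sum]
    exact Finset.single_le_sum (f := fun i => gap F θ i * expectedPulls F θ π T i)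
      (fun j _ => mul_nonneg (gap_nonneg F θ j) (expectedPulls_nonneg F θ π T j))
      (Finset.mem_univ i)
  rw [Real.norm_of_nonneg (expectedPulls_nonneg F θ π T i), inv_mul_eq_div,
    le_div_iff₀ (gap_pos hi), mul_comm]
  exact h1.trans (le_abs_self _)

lemma eventually_sum_expectedPulls_le {F : ParametricFamily Θ} {ε : ℝ} {G : SimpleGraph (Fin K)}
    {π : Policy K} (hπ : UniformlyGood F ε G π) {θ : Fin K → Θ} (hG : simGraph F ε θ = G)
    {s : Finset (Fin K)} (hs : ∀ i ∈ s, i ∉ optimalArms F θ) {α : ℝ} (hα : 0 < α)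
    {c : ℝ} (hc : 0 < c) :
    ∀ᶠ T : ℕ in atTop, ∑ i ∈ s, expectedPulls F θ π T i ≤ c * (T : ℝ) ^ α := by
  have h : (fun T : ℕ => ∑ i ∈ s, expectedPulls F θ π T i)
      =o[atTop] (fun T : ℕ => (T : ℝ) ^ α) :=
    IsLittleO.fun_sum fun i hi => expectedPulls_isLittleO hπ hG (hs i hi) hα
  filter_upwards [h.bound hc] with T hT
  rw [Real.norm_of_nonneg (by positivity : (0 : ℝ) ≤ (T : ℝ) ^ α)] at hT
  exact (le_abs_self _).trans hT

/-- Markov's inequality for the number of plays of a set of arms. -/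
lemma measureReal_le_sum_pullCount (F : ParametricFamily Θ) (θ : Fin K → Θ) (π : Policy K)
    (T : ℕ) (s : Finset (Fin K)) (c : ℝ) :
    c * (historyLaw F θ π T).real {h | c ≤ ∑ i ∈ s, pullCount i h}
      ≤ ∑ i ∈ s, expectedPulls F θ π T i := by
  have hint : Integrable (fun h : History K T => ∑ i ∈ s, pullCount i h) (historyLaw F θ π T) :=
    integrable_finsetSum _ fun i _ => integrable_pullCount F θ π T i
  refine (mul_meas_ge_le_integral_of_nonneg
    (ae_of_all _ fun h => Finset.sum_nonneg fun i _ => pullCount_nonneg i h) hint c).trans ?_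
  rw [integral_finsetSum _ fun i _ => integrable_pullCount F θ π T i]
  rfl

/-! ### Change of measure -/

open Classical in
/-- If two sets of arm parameters give rise to the same graph and have no optimal arm in common,
then a uniformly good policy has to collect an information of asymptotically at least `log T`
under the first one to tell it from the second one: the optimal arms of the second are played in
fewer than half of the rounds with a probability that tends to one under the first parameters and
is `O(T^(α-1))` under the second ones. -/
lemma eventually_log_le_sum_kl {F : ParametricFamily Θ} {ε : ℝ} {G : SimpleGraph (Fin K)}
    {π : Policy K} (hπ : UniformlyGood F ε G π) {θ θ'' : Fin K → Θ}
    (hG : simGraph F ε θ = G) (hG'' : simGraph F ε θ'' = G)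
    (hdisj : ∀ i ∈ optimalArms F θ'', i ∉ optimalArms F θ)
    (hfin : ∀ i, F.kl (θ i) (θ'' i) ≠ ∞) {e : ℝ} (he : 0 < e) :
    ∀ᶠ T : ℕ in atTop, (1 - e) * Real.log T
      ≤ ∑ i, expectedPulls F θ π T i * (F.kl (θ i) (θ'' i)).toReal := by
  set a : ℝ := min e 1 / 4 with ha
  have ha0 : 0 < a := by positivity
  have ha1 : a ≤ 1 / 4 := by have := min_le_right e 1; linarith
  have hae : 4 * a ≤ e := by have := min_le_left e 1; linarith
  set s : Finset (Fin K) := Finset.univ.filter (fun i => i ∈ optimalArms F θ'') with hs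
  have h1 := eventually_sum_expectedPulls_le hπ hG (s := s)
    (fun i hi => hdisj i (by simpa [hs] using hi)) one_pos (c := a / 2) (by positivity)
  have h2 := eventually_sum_expectedPulls_le hπ hG'' (s := sᶜ)
    (fun i hi => by simpa [hs] using hi) ha0 (c := 1 / 2) (by norm_num)
  have h3 : ∀ᶠ T : ℕ in atTop, 1 ≤ a * Real.log T :=
    ((Real.tendsto_log_atTop.comp tendsto_natCast_atTop_atTop).const_mul_atTop ha0).eventually_ge_atTop
      1
  filter_upwards [h1, h2, h3, eventually_ge_atTop 1] with T hT1 hT2 hT3 hT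
  have hTpos : (0 : ℝ) < T := by exact_mod_cast hT
  set P := historyLaw F θ π T
  set Q := historyLaw F θ'' π T
  set E : Set (History K T) := {h | ∑ i ∈ s, pullCount i h < (T : ℝ) / 2} with hE
  have hEm : MeasurableSet E :=
    measurableSet_lt (Finset.measurable_sum _ fun i _ => measurable_pullCount i) measurable_const
  -- the event is likely under the first parameters
  have hp : 1 - a ≤ P.real E := by
    have h := (measureReal_le_sum_pullCount F θ π T s ((T : ℝ) / 2)).trans hT1
    have hEc : {h : History K T | (T : ℝ) / 2 ≤ ∑ i ∈ s, pullCount i h} = Eᶜ := by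
      ext h; simp [hE]
    rw [hEc, Real.rpow_one, probReal_compl_eq_one_sub hEm] at h
    have h' : (T : ℝ) / 2 * (1 - P.real E) ≤ (T : ℝ) / 2 * a := by linarith
    have := le_of_mul_le_mul_left h' (by positivity)
    linarith
  -- and unlikely under the second ones
  have hq : Q.real E ≤ (T : ℝ) ^ (a - 1) := by
    have h := (measureReal_le_sum_pullCount F θ'' π T sᶜ ((T : ℝ) / 2)).trans hT2
    have hsub : E ⊆ {h : History K T | (T : ℝ) / 2 ≤ ∑ i ∈ sᶜ, pullCount i h} := fun h hh => by
      have hsum := Finset.sum_add_sum_compl s (fun i => pullCount i h)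
      rw [sum_pullCount] at hsum
      simp only [hE, Set.mem_ofPred_eq] at hh ⊢
      linarith
    have h5 := mul_le_mul_of_nonneg_left (measureReal_mono (μ := Q) hsub)
      (by positivity : (0 : ℝ) ≤ (T : ℝ) / 2)
    have h6 : (T : ℝ) ^ a = T * (T : ℝ) ^ (a - 1) := by
      rw [Real.rpow_sub_one hTpos.ne']
      field_simp
    rw [h6] at h
    have h7 : (T : ℝ) / 2 * Q.real E ≤ (T : ℝ) / 2 * (T : ℝ) ^ (a - 1) := by linarith
    exact le_of_mul_le_mul_left h7 (by positivity)
  have hkl := klDiv_historyLaw_le F θ θ'' π hfin T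
  have hklfin : klDiv P Q ≠ ∞ := ne_top_of_le_ne_top ENNReal.ofReal_ne_top hkl
  have hsum0 : 0 ≤ ∑ i, expectedPulls F θ π T i * (F.kl (θ i) (θ'' i)).toReal :=
    Finset.sum_nonneg fun i _ =>
      mul_nonneg (expectedPulls_nonneg F θ π T i) ENNReal.toReal_nonneg
  refine le_trans ?_ (ENNReal.toReal_le_of_le_ofReal hsum0 hkl)
  refine le_trans ?_ (measureReal_mul_log_le_toReal_klDiv P Q hEm hklfin)
  have hp0 : 0 < P.real E := by linarith
  have hp1 : P.real E ≤ 1 := measureReal_le_one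
  have hq0 : 0 < Q.real E := by
    refine lt_of_le_of_ne measureReal_nonneg fun h0 => hp0.ne' ?_
    have hQ : Q E = 0 := by
      rw [← ofReal_measureReal, ← h0, ENNReal.ofReal_zero]
    simp [measureReal_def, (klDiv_ne_top_iff.1 hklfin).1 hQ]
  have hlogq : Real.log (Q.real E) ≤ (a - 1) * Real.log T := by
    rw [← Real.log_rpow hTpos]
    exact Real.log_le_log hq0 hq
  have hplogp : P.real E - 1 ≤ P.real E * Real.log (P.real E) := by
    have h := mul_le_mul_of_nonneg_left (Real.one_sub_inv_le_log_of_pos hp0) hp0.le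
    rwa [mul_sub, mul_one, mul_inv_cancel₀ hp0.ne'] at h
  have hlogT : 0 ≤ Real.log T := Real.log_natCast_nonneg T
  have h8 : (1 - a) * ((1 - a) * Real.log T) ≤ P.real E * ((1 - a) * Real.log T) :=
    mul_le_mul_of_nonneg_right hp (mul_nonneg (by linarith) hlogT)
  have h9 : P.real E * Real.log (Q.real E) ≤ P.real E * ((a - 1) * Real.log T) :=
    mul_le_mul_of_nonneg_left hlogq hp0.le
  have h10 : (4 * a) * Real.log T ≤ e * Real.log T := mul_le_mul_of_nonneg_right hae hlogT
  rw [Real.log_div hp0.ne' hq0.ne']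
  nlinarith [mul_nonneg (sq_nonneg a) hlogT]

/-! ### Neighborhood classes of the similarity graph -/

lemma simGraph_eq_of_forall {F : ParametricFamily Θ} {ε : ℝ} {θ θ'' : Fin K → Θ}
    (h : ∀ i j, |F.mean (θ'' i) - F.mean (θ'' j)| < ε ↔ |F.mean (θ i) - F.mean (θ j)| < ε) :
    simGraph F ε θ'' = simGraph F ε θ := by
  ext i j
  exact and_congr_right fun _ => h i j

lemma mem_closedNbhd_simGraph {F : ParametricFamily Θ} {ε : ℝ} (hε : 0 < ε) {θ : Fin K → Θ}
    {i j : Fin K} :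
    j ∈ closedNbhd (simGraph F ε θ) i ↔ |F.mean (θ i) - F.mean (θ j)| < ε := by
  rcases eq_or_ne i j with rfl | h
  · simp [closedNbhd, hε]
  · simp [closedNbhd, simGraph, h, h.symm]

lemma mem_nbhdClass_simGraph {F : ParametricFamily Θ} {ε : ℝ} (hε : 0 < ε) {θ : Fin K → Θ}
    {i j : Fin K} :
    j ∈ nbhdClass (simGraph F ε θ) i ↔ ∀ k, |F.mean (θ j) - F.mean (θ k)| < ε ↔
      |F.mean (θ i) - F.mean (θ k)| < ε := by
  simp only [nbhdClass, Set.mem_ofPred_eq, Set.ext_iff, mem_closedNbhd_simGraph hε]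

lemma mem_nbhdClass_self (G : SimpleGraph (Fin K)) (i : Fin K) : i ∈ nbhdClass G i := rfl

lemma mem_nbhdClass_imax {F : ParametricFamily Θ} {ε : ℝ} (hε : 0 < ε) {θ : Fin K → Θ}
    {imax j : Fin K} (hmax : imax ∈ optimalArms F θ) :
    j ∈ nbhdClass (simGraph F ε θ) imax ↔ ∀ k, |F.mean (θ j) - F.mean (θ k)| < ε ↔
      F.mean (θ imax) - F.mean (θ k) < ε := by
  rw [mem_nbhdClass_simGraph hε]
  refine forall_congr' fun k => ?_
  rw [abs_of_nonneg (sub_nonneg.2 (hmax k))]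

/-- The class of an optimal arm consists of the arms with the largest means. -/
lemma mean_lt_of_notMem_nbhdClass {F : ParametricFamily Θ} {ε : ℝ} (hε : 0 < ε) {θ : Fin K → Θ}
    {imax j k : Fin K} (hmax : imax ∈ optimalArms F θ)
    (hk : k ∈ nbhdClass (simGraph F ε θ) imax) (hj : j ∉ nbhdClass (simGraph F ε θ) imax) :
    F.mean (θ j) < F.mean (θ k) := by
  by_contra! hle
  refine hj ((mem_nbhdClass_imax hε hmax).2 fun l => ?_)
  have hk' := (mem_nbhdClass_imax hε hmax).1 hk
  have hkk : F.mean (θ imax) - F.mean (θ k) < ε := (hk' k).1 (by simpa using hε)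
  have hkl := hk' l
  have hl := hmax l
  have hjm := hmax j
  simp only [abs_lt] at hkl ⊢
  constructor
  · rintro ⟨h1, h2⟩
    rcases le_total (F.mean (θ l)) (F.mean (θ k)) with h | h
    · exact hkl.1 ⟨by linarith, by linarith⟩
    · linarith
  · intro h
    exact ⟨by linarith, by linarith⟩

lemma optimalArms_subset_nbhdClass {F : ParametricFamily Θ} {ε : ℝ} (hε : 0 < ε)
    {θ : Fin K → Θ} {imax : Fin K} (hmax : imax ∈ optimalArms F θ) :
    optimalArms F θ ⊆ nbhdClass (simGraph F ε θ) imax := fun i hi => by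
  by_contra h
  exact (mean_lt_of_notMem_nbhdClass hε hmax (mem_nbhdClass_self _ imax) h).not_ge (hi imax)

/-- In a similarity graph that is not complete, a worst arm is not equivalent to an optimal arm. -/
lemma imin_notMem_nbhdClass {F : ParametricFamily Θ} {ε : ℝ} (hε : 0 < ε) {θ : Fin K → Θ}
    {imax imin : Fin K} (htop : simGraph F ε θ ≠ ⊤)
    (hmax : imax ∈ optimalArms F θ) (hmin : imin ∈ worstArms F θ) :
    imin ∉ nbhdClass (simGraph F ε θ) imax := fun h => by
  have h1 := ((mem_nbhdClass_imax hε hmax).1 h imin).1 (by simpa using hε)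
  refine htop ?_
  ext i j
  simp only [simGraph, SimpleGraph.top_adj, ne_eq, and_iff_left_iff_imp]
  intro _
  have := hmax i
  have := hmax j
  have := hmin i
  have := hmin j
  rw [abs_lt]
  constructor <;> linarith

lemma exists_sInf_mean_nbhdClass (F : ParametricFamily Θ) (θ : Fin K → Θ)
    (G : SimpleGraph (Fin K)) (i : Fin K) :
    ∃ k ∈ nbhdClass G i, F.mean (θ k) = sInf ((fun k => F.mean (θ k)) '' nbhdClass G i) :=
  Set.Nonempty.csInf_mem ⟨_, Set.mem_image_of_mem _ (mem_nbhdClass_self G i)⟩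
    ((nbhdClass G i).toFinite.image _)

lemma sInf_mean_nbhdClass_le (F : ParametricFamily Θ) (θ : Fin K → Θ)
    {G : SimpleGraph (Fin K)} {i j : Fin K} (hj : j ∈ nbhdClass G i) :
    sInf ((fun k => F.mean (θ k)) '' nbhdClass G i) ≤ F.mean (θ j) :=
  csInf_le ((nbhdClass G i).toFinite.image _).bddBelow (Set.mem_image_of_mem _ hj)

/-! ### Two perturbations that keep the graph -/

/-- Raising an arm of the class of the optimal arms slightly above the largest mean keeps the
graph. -/
lemma simGraph_update_eq {F : ParametricFamily Θ} {ε : ℝ} (hε : 0 < ε) {θ : Fin K → Θ}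
    {imax i : Fin K} (hmax : imax ∈ optimalArms F θ)
    (hi : i ∈ nbhdClass (simGraph F ε θ) imax) {l : Θ} (hl : F.mean (θ imax) < F.mean l)
    (hlε : ∀ j, F.mean (θ imax) - F.mean (θ j) < ε → F.mean l - F.mean (θ j) < ε) :
    simGraph F ε (Function.update θ i l) = simGraph F ε θ := by
  have key : ∀ j, |F.mean l - F.mean (θ j)| < ε ↔ |F.mean (θ i) - F.mean (θ j)| < ε := fun j => by
    have hj := hmax j
    rw [(mem_nbhdClass_imax hε hmax).1 hi j, abs_of_nonneg (by linarith)]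
    exact ⟨fun h => by linarith, hlε j⟩
  refine simGraph_eq_of_forall fun a b => ?_
  rcases eq_or_ne a i with rfl | ha <;> rcases eq_or_ne b a with rfl | hb
  · simp
  · simpa [Function.update_of_ne hb] using key b
  · simp
  · rcases eq_or_ne b i with rfl | hb'
    · simp only [Function.update_self, Function.update_of_ne ha]
      rw [abs_sub_comm, key a, abs_sub_comm]
    · simp only [Function.update_of_ne ha, Function.update_of_ne hb']

lemma optimalArms_update_subset {F : ParametricFamily Θ} {θ : Fin K → Θ}
    {imax i : Fin K} (hmax : imax ∈ optimalArms F θ) {l : Θ}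
    (hl : F.mean (θ imax) < F.mean l) :
    optimalArms F (Function.update θ i l) ⊆ {i} := fun j hj => by
  by_contra h
  have h1 := hj i
  rw [Function.update_self, Function.update_of_ne (by simpa using h)] at h1
  have := hmax j
  linarith

/-- The mirrored means give rise to the same graph. The class of the optimal arms is left in place;
this makes no difference because the reflection maps the range of its means to itself and all its
members have the same neighbors. The members of the class of the worst arms may be moved to the same
point because they have the same neighbors too. -/
lemma simGraph_eq_of_altMean {F : ParametricFamily Θ} {ε : ℝ} (hε : 0 < ε) {θ θ'' : Fin K → Θ}
    {imax imin : Fin K} (hmax : imax ∈ optimalArms F θ) (hmin : imin ∈ worstArms F θ)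
    (h : ∀ j, F.mean (θ'' j) = altMean F ε θ imax imin j) :
    simGraph F ε θ'' = simGraph F ε θ := by
  classical
  set B := nbhdClass (simGraph F ε θ) imax with hB
  set W := nbhdClass (simGraph F ε θ) imin with hW
  set m : Fin K → ℝ := fun j => F.mean (θ j) with hm
  obtain ⟨k₀, hk₀, hb⟩ := exists_sInf_mean_nbhdClass F θ (simGraph F ε θ) imax
  -- the means with the class of the worst arms collapsed to a point
  set r : Fin K → ℝ := fun j => if j ∈ W then m imin else m j with hr
  have hW' : ∀ j ∈ W, ∀ k, |m j - m k| < ε ↔ |m imin - m k| < ε := fun j hj k =>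
    (mem_nbhdClass_simGraph hε).1 hj k
  have hrm : ∀ i j, |r i - r j| < ε ↔ |m i - m j| < ε := fun i j => by
    have hr1 : ∀ i x, |r i - m x| < ε ↔ |m i - m x| < ε := fun i x => by
      simp only [hr]
      split_ifs with hi
      · exact (hW' i hi x).symm
      · rfl
    by_cases hi : i ∈ W
    · rw [show r i = m imin from if_pos hi, abs_sub_comm, hr1, abs_sub_comm]
      exact (hW' i hi j).symm
    · rw [show r i = m i from if_neg hi, abs_sub_comm, hr1, abs_sub_comm]
  have hr_le : ∀ j, r j ≤ m j := fun j => by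
    simp only [hr]
    split_ifs
    · exact hmin j
    · rfl
  have hin : ∀ j ∈ B, F.mean (θ'' j) = m j := fun j hj => by
    rw [h, altMean]
    exact if_pos hj
  have hout : ∀ j ∉ B, F.mean (θ'' j) = m imax + m k₀ - r j := fun j hj => by
    rw [h, altMean, ← hb]
    simp only [hr]
    rw [if_neg hj]
    split_ifs <;> rfl
  have hcross : ∀ i ∈ B, ∀ j ∉ B,
      |F.mean (θ'' i) - F.mean (θ'' j)| < ε ↔ |m i - m j| < ε := fun i hi j hj => by
    have hjk : m j < m k₀ := mean_lt_of_notMem_nbhdClass hε hmax hk₀ hj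
    have hki : m k₀ ≤ m i := hb.trans_le (sInf_mean_nbhdClass_le F θ hi)
    have him : m i ≤ m imax := hmax i
    have hrj := hr_le j
    have e1 : |m i - m j| < ε ↔ m imax - m j < ε := (mem_nbhdClass_imax hε hmax).1 hi j
    have e2 : |m k₀ - m j| < ε ↔ m imax - m j < ε := (mem_nbhdClass_imax hε hmax).1 hk₀ j
    have e3 : m imax - m j < ε → m imax - r j < ε := fun h3 => by
      simp only [hr]
      split_ifs with hjW
      · have := (hW' j hjW imax).1 (by rwa [abs_sub_comm, abs_of_nonneg (by linarith)])
        rw [abs_lt] at this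
        linarith
      · exact h3
    rw [hin i hi, hout j hj, abs_sub_comm, abs_of_nonneg (by linarith), e1]
    constructor
    · intro h4
      exact e2.1 (by rw [abs_of_nonneg (by linarith)]; linarith)
    · intro h4
      have := e3 h4
      linarith
  refine simGraph_eq_of_forall fun i j => ?_
  by_cases hi : i ∈ B <;> by_cases hj : j ∈ B
  · rw [hin i hi, hin j hj]
  · exact hcross i hi j hj
  · rw [abs_sub_comm, hcross j hj i hi, abs_sub_comm]
  · rw [hout i hi, hout j hj, ← hrm i j, abs_sub_comm (r i)]
    have : m imax + m k₀ - r i - (m imax + m k₀ - r j) = r j - r i := by ring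
    rw [this]

lemma mean_lt_altMean_of_notMem {F : ParametricFamily Θ} {ε : ℝ} (hε : 0 < ε) {θ : Fin K → Θ}
    {imax imin j : Fin K} (htop : simGraph F ε θ ≠ ⊤) (hmax : imax ∈ optimalArms F θ)
    (hmin : imin ∈ worstArms F θ) (hj : j ∉ nbhdClass (simGraph F ε θ) imax) :
    F.mean (θ imax) < altMean F ε θ imax imin j := by
  obtain ⟨k₀, hk₀, hb⟩ := exists_sInf_mean_nbhdClass F θ (simGraph F ε θ) imax
  have h1 := mean_lt_of_notMem_nbhdClass hε hmax hk₀ hj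
  have h2 := mean_lt_of_notMem_nbhdClass hε hmax hk₀ (imin_notMem_nbhdClass hε htop hmax hmin)
  simp only [altMean, if_neg hj, ← hb]
  split_ifs <;> linarith

/-! ### The two asymptotic constraints -/

/-- A suboptimal arm `i` that is equivalent to the optimal arms has to be played about
`log T / I(θ_i ‖ θ_imax)` times. -/
lemma eventually_log_le_expectedPulls_mul_kl {F : ParametricFamily Θ} {ε : ℝ} (hε : 0 < ε)
    (hpos : F.KLFinitePos) (hcont : F.KLRightCont) (hsurj : F.UnboundedMeans)
    {θ : Fin K → Θ} {imax : Fin K} (hmax : imax ∈ optimalArms F θ)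
    {π : Policy K} (hπ : UniformlyGood F ε (simGraph F ε θ) π)
    {i : Fin K} (hi : i ∈ nbhdClass (simGraph F ε θ) imax \ optimalArms F θ)
    {e : ℝ} (he : 0 < e) :
    ∀ᶠ T : ℕ in atTop,
      (1 - e) * Real.log T ≤ expectedPulls F θ π T i * (F.kl (θ i) (θ imax)).toReal := by
  have hlt : F.mean (θ i) < F.mean (θ imax) := by
    have := gap_pos hi.2
    rw [gap, maxMean_eq_of_mem_optimalArms hmax] at this
    linarith
  set I := (F.kl (θ i) (θ imax)).toReal with hI
  have hI0 : 0 < I := ENNReal.toReal_pos (hpos _ _ hlt).1.ne' (hpos _ _ hlt).2.ne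
  -- a loss of `a`, both in the information and in the change of measure, costs at most `e`:
  -- `(1 - e) * (I + a) ≤ (1 - a) * I`
  set a := e * I / (1 + I) with ha
  have ha0 : 0 < a := by positivity
  obtain ⟨η, hη, hη'⟩ := hcont a ha0 _ _ hlt
  have hnear : ∀ᶠ x in 𝓝[>] F.mean (θ imax), x < F.mean (θ imax) + η ∧
      ∀ j, F.mean (θ imax) - F.mean (θ j) < ε → x - F.mean (θ j) < ε := by
    refine Eventually.filter_mono nhdsWithin_le_nhds ?_
    refine (eventually_lt_nhds (by linarith)).and (eventually_all.2 fun j => ?_)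
    by_cases hj : F.mean (θ imax) - F.mean (θ j) < ε
    · filter_upwards [eventually_lt_nhds (show F.mean (θ imax) < ε + F.mean (θ j) by linarith)]
        with x hx _
      linarith
    · exact Eventually.of_forall fun x h => absurd h hj
  obtain ⟨x, ⟨hxη, hxε⟩, hx⟩ := (hnear.and self_mem_nhdsWithin).exists
  obtain ⟨l, rfl⟩ := hsurj x
  have hl : F.mean (θ imax) < F.mean l := hx
  have hkl : (F.kl (θ i) l).toReal ≤ I + a := by
    have := (abs_lt.1 (hη' l hl hxη)).1
    linarith
  have hfin : ∀ j, F.kl (θ j) (Function.update θ i l j) ≠ ∞ := fun j => by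
    rcases eq_or_ne j i with rfl | hj
    · rw [Function.update_self]
      exact (hpos _ _ (hlt.trans hl)).2.ne
    · simp [Function.update_of_ne hj, ParametricFamily.kl]
  filter_upwards [eventually_log_le_sum_kl hπ rfl (simGraph_update_eq hε hmax hi.1 hl hxε)
    (fun j hj => by
      rw [Set.mem_singleton_iff.1 (optimalArms_update_subset hmax hl hj)]
      exact hi.2) hfin ha0] with T hT
  rw [Finset.sum_eq_single i (fun j _ hj => by
    simp [Function.update_of_ne hj, ParametricFamily.kl]) (by simp), Function.update_self] at hT
  have hN := expectedPulls_nonneg F θ π T i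
  have hlog : 0 ≤ Real.log T := Real.log_natCast_nonneg T
  have h1 : (1 - a) * Real.log T ≤ expectedPulls F θ π T i * (I + a) :=
    hT.trans (mul_le_mul_of_nonneg_left hkl hN)
  have h2 : (1 - e) * (I + a) ≤ (1 - a) * I := by
    have h3 : a * (1 + I) = e * I := by rw [ha]; field_simp
    nlinarith [mul_pos he ha0]
  have h4 : ((1 - e) * Real.log T) * (I + a) ≤ (expectedPulls F θ π T i * I) * (I + a) := by
    have h5 := mul_le_mul_of_nonneg_right h2 hlog
    have h6 := mul_le_mul_of_nonneg_right h1 hI0.le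
    linarith
  exact le_of_mul_le_mul_right h4 (by positivity)

open Classical in
/-- The arms outside the class of the optimal arms have to be played often enough to rule out the
mirrored means. -/
lemma eventually_log_le_sum_expectedPulls_mul_kl {F : ParametricFamily Θ} {ε : ℝ} (hε : 0 < ε)
    (hpos : F.KLFinitePos) {θ θ' : Fin K → Θ} {imax imin : Fin K}
    (htop : simGraph F ε θ ≠ ⊤) (hmax : imax ∈ optimalArms F θ) (hmin : imin ∈ worstArms F θ)
    (hθ' : ∀ j, F.mean (θ' j) = altMean F ε θ imax imin j)
    {π : Policy K} (hπ : UniformlyGood F ε (simGraph F ε θ) π) {e : ℝ} (he : 0 < e) :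
    ∀ᶠ T : ℕ in atTop, (1 - e) * Real.log T
      ≤ ∑ j ∈ Finset.univ.filter (fun j => j ∉ nbhdClass (simGraph F ε θ) imax),
          expectedPulls F θ π T j * (F.kl (θ j) (θ' j)).toReal := by
  -- `θ'` need not agree with `θ` on the class of the optimal arms, only its means do
  set θ'' : Fin K → Θ := fun j => if j ∈ nbhdClass (simGraph F ε θ) imax then θ j else θ' j
    with hdef
  have hin : ∀ j ∈ nbhdClass (simGraph F ε θ) imax, θ'' j = θ j := fun j hj => if_pos hj
  have hout : ∀ j ∉ nbhdClass (simGraph F ε θ) imax, θ'' j = θ' j := fun j hj => if_neg hj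
  have hmean : ∀ j, F.mean (θ'' j) = altMean F ε θ imax imin j := fun j => by
    by_cases hj : j ∈ nbhdClass (simGraph F ε θ) imax
    · rw [hin j hj, altMean]
      exact (if_pos hj).symm
    · rw [hout j hj, hθ']
  have hlt : ∀ j ∉ nbhdClass (simGraph F ε θ) imax, F.mean (θ imax) < F.mean (θ'' j) :=
    fun j hj => (mean_lt_altMean_of_notMem hε htop hmax hmin hj).trans_eq (hmean j).symm
  have hfin : ∀ j, F.kl (θ j) (θ'' j) ≠ ∞ := fun j => by
    by_cases hj : j ∈ nbhdClass (simGraph F ε θ) imax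
    · simp [hin j hj, ParametricFamily.kl]
    · exact (hpos _ _ ((hmax j).trans_lt (hlt j hj))).2.ne
  filter_upwards [eventually_log_le_sum_kl hπ rfl (simGraph_eq_of_altMean hε hmax hmin hmean)
    (fun j hj hj' => by
      have h1 := hj imin
      have h2 := hlt imin (imin_notMem_nbhdClass hε htop hmax hmin)
      rw [hin j (optimalArms_subset_nbhdClass hε hmax hj')] at h1
      have h3 := hmax j
      linarith) hfin he] with T hT
  refine hT.trans_eq ?_
  rw [Finset.sum_filter]
  refine Finset.sum_congr rfl fun j _ => ?_
  by_cases hj : j ∈ nbhdClass (simGraph F ε θ) imax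
  · simp [hj, hin j hj, ParametricFamily.kl]
  · simp [hj, hout j hj]

/-! ### The linear program -/

open Classical in
/-- The minimum of the linear program is attained: the lower bounds on the class of the optimal
arms are met with equality, and the information constraint is met by the single arm outside the
class that has the smallest ratio of gap and divergence. -/
lemma exists_isLeast_lpValues {F : ParametricFamily Θ} {ε : ℝ} {θ θ' : Fin K → Θ}
    {imax imin : Fin K} (himin : imin ∉ nbhdClass (simGraph F ε θ) imax)
    (hI : ∀ j ∉ nbhdClass (simGraph F ε θ) imax, 0 < (F.kl (θ j) (θ' j)).toReal) :
    ∃ C₁, IsLeast (lpValues F ε θ θ' imax) C₁ := by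
  set B := nbhdClass (simGraph F ε θ) imax
  set s : Finset (Fin K) := Finset.univ.filter (fun j => j ∉ B) with hs
  have hsB : ∀ j, j ∈ s ↔ j ∉ B := fun j => by simp [hs]
  obtain ⟨j₀, hj₀, hmin⟩ := s.exists_min_image
    (fun j => gap F θ j / (F.kl (θ j) (θ' j)).toReal) ⟨imin, (hsB _).2 himin⟩
  have hj₀B := (hsB _).1 hj₀
  have hI₀ := hI j₀ hj₀B
  set r := gap F θ j₀ / (F.kl (θ j₀) (θ' j₀)).toReal with hr
  have hr0 : 0 ≤ r := div_nonneg (gap_nonneg F θ j₀) hI₀.le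
  set σ : Fin K → ℝ := fun i => if i ∈ B then
      (if i ∈ optimalArms F θ then 0 else 1 / (F.kl (θ i) (θ imax)).toReal)
    else if i = j₀ then 1 / (F.kl (θ j₀) (θ' j₀)).toReal else 0 with hσ
  have hσs : ∀ j ∈ s, σ j = if j = j₀ then 1 / (F.kl (θ j₀) (θ' j₀)).toReal else 0 :=
    fun j hj => if_neg ((hsB j).1 hj)
  refine ⟨∑ i, gap F θ i * σ i, ⟨σ, ⟨?_, ?_, ?_⟩, rfl⟩, ?_⟩
  · change 1 ≤ ∑ j ∈ s, σ j * (F.kl (θ j) (θ' j)).toReal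
    rw [Finset.sum_congr rfl fun j hj => by rw [hσs j hj]]
    simp only [ite_mul, zero_mul, Finset.sum_ite_eq', if_pos hj₀]
    rw [one_div, inv_mul_cancel₀ hI₀.ne']
  · intro i hi
    simp only [hσ]
    rw [if_pos hi.1, if_neg hi.2]
  · intro i
    simp only [hσ]
    split_ifs <;> positivity
  · rintro _ ⟨τ, ⟨h1, h2, h3⟩, rfl⟩
    simp only
    rw [← Finset.sum_add_sum_compl s, ← Finset.sum_add_sum_compl s (fun i => gap F θ i * τ i)]
    refine add_le_add ?_ (Finset.sum_le_sum fun i hi => ?_)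
    · calc ∑ i ∈ s, gap F θ i * σ i = r := by
            rw [Finset.sum_congr rfl fun j hj => by rw [hσs j hj]]
            simp only [mul_ite, mul_zero, Finset.sum_ite_eq', if_pos hj₀]
            rw [mul_one_div]
        _ ≤ r * ∑ j ∈ s, τ j * (F.kl (θ j) (θ' j)).toReal := le_mul_of_one_le_right hr0 h1
        _ ≤ ∑ i ∈ s, gap F θ i * τ i := by
            rw [Finset.mul_sum]
            refine Finset.sum_le_sum fun j hj => ?_
            have h4 := (le_div_iff₀ (hI j ((hsB j).1 hj))).1 (hmin j hj)
            have h5 := mul_le_mul_of_nonneg_right h4 (h3 j)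
            linarith
    · have hiB : i ∈ B := by
        by_contra h
        exact (Finset.mem_compl.1 hi) ((hsB i).2 h)
      by_cases hiA : i ∈ optimalArms F θ
      · simp [gap_eq_zero hiA]
      · refine mul_le_mul_of_nonneg_left ?_ (gap_nonneg F θ i)
        simp only [hσ]
        rw [if_pos hiB, if_neg hiA]
        exact h2 i ⟨hiB, hiA⟩

open Classical in
/-- Each suboptimal arm equivalent to the optimal arms, and the remaining arms together, add at
least `δ / D` to the objective of the linear program. -/
lemma mul_le_of_mem_lpValues {F : ParametricFamily Θ} {ε : ℝ} {θ θ' : Fin K → Θ} {imax : Fin K}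
    (hA : optimalArms F θ ⊆ nbhdClass (simGraph F ε θ) imax)
    {δ D : ℝ} (hδ : 0 < δ) (hD : 0 < D)
    (hgap : ∀ i, i ∉ optimalArms F θ → δ ≤ gap F θ i)
    (hkl : ∀ j, j ∉ nbhdClass (simGraph F ε θ) imax → (F.kl (θ j) (θ' j)).toReal ≤ D)
    (hklB : ∀ i ∈ nbhdClass (simGraph F ε θ) imax \ optimalArms F θ,
      0 < (F.kl (θ i) (θ imax)).toReal ∧ (F.kl (θ i) (θ imax)).toReal ≤ D)
    {v : ℝ} (hv : v ∈ lpValues F ε θ θ' imax) :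
    δ / D * (1 + ((nbhdClass (simGraph F ε θ) imax \ optimalArms F θ).ncard : ℝ)) ≤ v := by
  obtain ⟨τ, ⟨h1, h2, h3⟩, rfl⟩ := hv
  set B := nbhdClass (simGraph F ε θ) imax
  set s : Finset (Fin K) := Finset.univ.filter (fun j => j ∉ B) with hs
  set t : Finset (Fin K) := Finset.univ.filter (fun j => j ∈ B \ optimalArms F θ) with ht
  have hst : Disjoint s t := Finset.disjoint_filter.2 fun j _ hj hj' => hj hj'.1
  have hcard : (B \ optimalArms F θ).ncard = t.card := by
    rw [← Set.ncard_coe_finset]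
    congr 1
    ext j
    simp [ht]
  have hsum : ∑ i ∈ s, gap F θ i * τ i + ∑ i ∈ t, gap F θ i * τ i ≤ ∑ i, gap F θ i * τ i := by
    rw [← Finset.sum_union hst]
    exact Finset.sum_le_sum_of_subset_of_nonneg (Finset.subset_univ _)
      fun i _ _ => mul_nonneg (gap_nonneg F θ i) (h3 i)
  have hs' : δ / D ≤ ∑ i ∈ s, gap F θ i * τ i := by
    calc δ / D = δ / D * 1 := (mul_one _).symm
      _ ≤ δ / D * ∑ j ∈ s, τ j * (F.kl (θ j) (θ' j)).toReal :=
          mul_le_mul_of_nonneg_left h1 (by positivity)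
      _ ≤ _ := by
          rw [Finset.mul_sum]
          refine Finset.sum_le_sum fun j hj => ?_
          have hjB : j ∉ B := by simpa [hs] using hj
          have h4 := hgap j fun h => hjB (hA h)
          calc δ / D * (τ j * (F.kl (θ j) (θ' j)).toReal) ≤ δ / D * (τ j * D) := by
                have := h3 j
                have := hkl j hjB
                gcongr
            _ = δ * τ j := by field_simp
            _ ≤ gap F θ j * τ j := mul_le_mul_of_nonneg_right h4 (h3 j)
  have ht' : δ / D * t.card ≤ ∑ i ∈ t, gap F θ i * τ i := by
    rw [mul_comm, ← nsmul_eq_mul]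
    refine Finset.card_nsmul_le_sum _ _ _ fun i hi => ?_
    have hiB : i ∈ B \ optimalArms F θ := by simpa [ht] using hi
    have h4 := (one_div_le_one_div_of_le (hklB i hiB).1 (hklB i hiB).2).trans (h2 i hiB)
    rw [← mul_one_div]
    exact mul_le_mul (hgap i hiB.2) h4 (by positivity) (gap_nonneg F θ i)
  rw [hcard, mul_add, mul_one]
  exact (add_le_add hs' ht').trans hsum

/-- The normalized expected numbers of plays of a uniformly good policy are asymptotically feasible
for the linear program, hence its value bounds the regret. -/
lemma eventually_mul_log_le_regret {F : ParametricFamily Θ} {ε : ℝ} (hε : 0 < ε)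
    (hpos : F.KLFinitePos) (hcont : F.KLRightCont) (hsurj : F.UnboundedMeans)
    {θ θ' : Fin K → Θ} {imax imin : Fin K}
    (htop : simGraph F ε θ ≠ ⊤) (hmax : imax ∈ optimalArms F θ) (hmin : imin ∈ worstArms F θ)
    (hθ' : ∀ j, F.mean (θ' j) = altMean F ε θ imax imin j)
    {π : Policy K} (hπ : UniformlyGood F ε (simGraph F ε θ) π)
    {C : ℝ} (hC : IsLeast (lpValues F ε θ θ' imax) C) {e : ℝ} (he : 0 < e) (he1 : e < 1) :
    ∀ᶠ T : ℕ in atTop, (1 - e) * C * Real.log T ≤ regret F θ π T := by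
  have hB : ∀ᶠ T : ℕ in atTop, ∀ i, i ∈ nbhdClass (simGraph F ε θ) imax \ optimalArms F θ →
      (1 - e) * Real.log T ≤ expectedPulls F θ π T i * (F.kl (θ i) (θ imax)).toReal := by
    refine eventually_all.2 fun i => ?_
    by_cases hi : i ∈ nbhdClass (simGraph F ε θ) imax \ optimalArms F θ
    · filter_upwards [eventually_log_le_expectedPulls_mul_kl hε hpos hcont hsurj hmax hπ hi he]
        with T hT _ using hT
    · exact Eventually.of_forall fun T h => absurd h hi
  filter_upwards [hB, eventually_log_le_sum_expectedPulls_mul_kl hε hpos htop hmax hmin hθ' hπ he,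
    eventually_ge_atTop 2] with T hTB hTs hT2
  have hlog : 0 < Real.log T := Real.log_pos (by exact_mod_cast hT2)
  have hc : 0 < (1 - e) * Real.log T := mul_pos (by linarith) hlog
  have hfeas : (fun i => expectedPulls F θ π T i / ((1 - e) * Real.log T))
      ∈ lpFeasible F ε θ θ' imax := by
    refine ⟨?_, fun i hi => ?_, fun i => div_nonneg (expectedPulls_nonneg F θ π T i) hc.le⟩
    · simp_rw [div_mul_eq_mul_div]
      rw [← Finset.sum_div, le_div_iff₀ hc, one_mul]
      exact hTs
    · have h := hTB i hi
      have hI : 0 < (F.kl (θ i) (θ imax)).toReal :=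
        pos_of_mul_pos_right (hc.trans_le h) (expectedPulls_nonneg F θ π T i)
      rw [div_le_div_iff₀ hI hc, one_mul]
      exact h
  have h := hC.2 ⟨_, hfeas, rfl⟩
  simp_rw [← mul_div_assoc] at h
  rw [← Finset.sum_div, ← regret_eq_sum, le_div_iff₀ hc] at h
  linarith

lemma kl_toReal_pos {F : ParametricFamily Θ} (hpos : F.KLFinitePos) {a b : Θ}
    (h : F.mean a < F.mean b) : 0 < (F.kl a b).toReal :=
  ENNReal.toReal_pos (hpos a b h).1.ne' (hpos a b h).2.ne

lemma exists_isLeast_lpValues_of_altMean {F : ParametricFamily Θ} {ε : ℝ} (hε : 0 < ε)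
    (hpos : F.KLFinitePos) {θ θ' : Fin K → Θ} {imax imin : Fin K}
    (htop : simGraph F ε θ ≠ ⊤) (hmax : imax ∈ optimalArms F θ) (hmin : imin ∈ worstArms F θ)
    (hθ' : ∀ j, F.mean (θ' j) = altMean F ε θ imax imin j) :
    ∃ C₁, IsLeast (lpValues F ε θ θ' imax) C₁ :=
  exists_isLeast_lpValues (imin_notMem_nbhdClass hε htop hmax hmin) fun j hj =>
    kl_toReal_pos hpos ((hmax j).trans_lt
      ((mean_lt_altMean_of_notMem hε htop hmax hmin hj).trans_eq (hθ' j).symm))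

end

end UIGBandit

open UIGBandit in
theorem theorem3 :
    -- the asymptotic lower bound by the optimal value of the linear program
    (∀ (K : ℕ) (Θ : Type*) (F : ParametricFamily Θ) (ε : ℝ) (θ θ' : Fin K → Θ)
        (imax imin : Fin K) (π : Policy K),
      0 < ε → F.KLFinitePos → F.KLRightCont → F.UnboundedMeans →
      (simGraph F ε θ).Connected → simGraph F ε θ ≠ ⊤ →
      imax ∈ optimalArms F θ → imin ∈ worstArms F θ →
      (∀ j, F.mean (θ' j) = altMean F ε θ imax imin j) →
      UniformlyGood F ε (simGraph F ε θ) π →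
      ∃ C₁ : ℝ, IsLeast (lpValues F ε θ θ' imax) C₁ ∧
        (C₁ : EReal) ≤
          liminf (fun T : ℕ => ((regret F θ π T / Real.log T : ℝ) : EReal)) atTop) ∧
    -- the order of the regret, with a constant that depends only on bounds on the gaps and on
    -- the divergences
    (∀ δ D : ℝ, 0 < δ → 0 < D → ∃ c : ℝ, 0 < c ∧
      ∀ (K : ℕ) (Θ : Type*) (F : ParametricFamily Θ) (ε : ℝ) (θ θ' : Fin K → Θ)
        (imax imin : Fin K) (π : Policy K),
      0 < ε → F.KLFinitePos → F.KLRightCont → F.UnboundedMeans →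
      (simGraph F ε θ).Connected → simGraph F ε θ ≠ ⊤ →
      imax ∈ optimalArms F θ → imin ∈ worstArms F θ →
      (∀ j, F.mean (θ' j) = altMean F ε θ imax imin j) →
      UniformlyGood F ε (simGraph F ε θ) π →
      (∀ i, i ∉ optimalArms F θ → δ ≤ gap F θ i) →
      (∀ j, j ∉ nbhdClass (simGraph F ε θ) imax → (F.kl (θ j) (θ' j)).toReal ≤ D) →
      (∀ i ∈ nbhdClass (simGraph F ε θ) imax \ optimalArms F θ,
        (F.kl (θ i) (θ imax)).toReal ≤ D) →
      ∀ᶠ T : ℕ in atTop,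
        c * (1 + ((nbhdClass (simGraph F ε θ) imax \ optimalArms F θ).ncard : ℝ)) *
          Real.log T ≤ regret F θ π T) := by
  constructor
  · intro K Θ F ε θ θ' imax imin π hε hpos hcont hsurj _ htop hmax hmin hθ' hπ
    obtain ⟨C, hC⟩ := exists_isLeast_lpValues_of_altMean hε hpos htop hmax hmin hθ'
    refine ⟨C, hC, ?_⟩
    have hC0 : 0 ≤ C := by
      obtain ⟨τ, hτ, rfl⟩ := hC.1
      exact Finset.sum_nonneg fun i _ => mul_nonneg (gap_nonneg F θ i) (hτ.2.2 i)
    refine EReal.ge_of_forall_gt_iff_ge.1 fun z hz => ?_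
    have hz' : z < C := by exact_mod_cast hz
    -- `e` is chosen with `z ≤ (1 - e) * C`
    set e := min (1 / 2) ((C - z) / (C + 1)) with he
    have he0 : 0 < e := lt_min (by norm_num) (div_pos (by linarith) (by linarith))
    have he1 : e < 1 := (min_le_left _ _).trans_lt (by norm_num)
    have hez : z ≤ (1 - e) * C := by
      have h1 : e * (C + 1) ≤ C - z := (le_div_iff₀ (by linarith)).1 (min_le_right _ _)
      linarith
    refine le_liminf_of_le (by isBoundedDefault) ?_
    filter_upwards [eventually_mul_log_le_regret hε hpos hcont hsurj htop hmax hmin hθ' hπ hC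
      he0 he1, eventually_ge_atTop 2] with T hT hT2
    have hlog : 0 < Real.log T := Real.log_pos (by exact_mod_cast hT2)
    exact_mod_cast hez.trans ((le_div_iff₀ hlog).2 hT)
  · intro δ D hδ hD
    refine ⟨δ / D / 2, by positivity, ?_⟩
    intro K Θ F ε θ θ' imax imin π hε hpos hcont hsurj _ htop hmax hmin hθ' hπ hgap hkl hklB
    obtain ⟨C, hC⟩ := exists_isLeast_lpValues_of_altMean hε hpos htop hmax hmin hθ'
    have hlow := mul_le_of_mem_lpValues (optimalArms_subset_nbhdClass hε hmax) hδ hD hgap hkl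
      (fun i hi => ⟨kl_toReal_pos hpos (by
        have := gap_pos hi.2
        rw [gap, maxMean_eq_of_mem_optimalArms hmax] at this
        linarith), hklB i hi⟩) hC.1
    filter_upwards [eventually_mul_log_le_regret hε hpos hcont hsurj htop hmax hmin hθ' hπ hC
      (e := 1 / 2) (by norm_num) (by norm_num)] with T hT
    refine le_trans (mul_le_mul_of_nonneg_right ?_ (Real.log_natCast_nonneg T)) hT
    linarith
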